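/- Let $m\ge n\ge 2$ be integers with $(m,n)\neq(2,2)$, and let $G=G_{m,n}=\langle x,y\mid x^m=y^n\rangle$. Put $s_1=xyx^{-m+1}$, $s_2=x^{m-1}y^{-1}$, $a=x$, $b=yx^{-m+1}$; each of $\mathcal S=\{s_1,s_2\}$ and $\mathcal A=\{a,b\}$ generates $G$. A left ordering of $G$ is a strict total order invariant under left multiplication; its positive cone is $\{g: 1<g\}$. The set $\mathrm{LO}(G)$ of left orderings carries the subspace topology from $\{+,-\}^{G\setminus\{1\}}$ (product of discrete spaces), and a left ordering is isolated if it is an isolated point of $\mathrm{LO}(G)$. Let $\Sigma_{\mathcal S}$ be the set of elements of $G$ represented by a word in $s_1^{\pm1},s_2^{\pm1}$ that either contains $s_1$ and not $s_1^{-1}$, or is a non-empty word in $s_2$ alone (without $s_1^{\pm1}$, $s_2^{-1}$). There are a left ordering $<_D$ of $G$ with positive cone $\Sigma_{\mathcal S}$ (the Dehornoy-like ordering defined by $\mathcal S$) and an isolated left ordering $<_A$ of $G$ whose positive cone is the set of non-empty products of elements of $\mathcal A$. They have the following properties. 1. The $<_D$-convex subgroups of $G$ are exactly $\{1\}$, $\langle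 s_2\rangle$ and $G$. 2. The $<_A$-convex subgroups of $G$ are exactly $\{1\}$, $\langle b\rangle$ and $G$. 3. The Conradian soul of $<_D$ is $\langle s_2\rangle$. 4. The Conradian soul of $<_A$ is $\langle b\rangle$. 5. $<_D$ is an accumulation point in $\mathrm{LO}(G)$ of the set of its conjugates $\{<_D\cdot\, g\}_{g\in G}$; hence $<_D$ is not isolated in $\mathrm{LO}(G)$, and the $\sigma(\mathcal S)$-positive monoid $\Sigma_{\mathcal S}\cup\{1\}$ is not finitely generated. Here a subgroup $H$ is $<$-convex if $h<g<h'$ with $h,h'\in H$, $g\in G$ implies $g\in H$; a left ordering is Conradian if $fg^k>g$ for all positive $f,g$ and all $k\ge2$; the Conradian soul of $<$ is the largest $<$-convex subgroup on which the restriction of $<$ is Conradian; and $<\cdot\, g$ is the left ordering in which $u$ is smaller than $v$ iff $ug<vg$. -/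

import Mathlib

open Topology Filter

/-! ### Left orderings and the space of left orderings -/

/-- A left ordering of a group: a strict total order invariant under left multiplication. -/
@[ext]
structure LeftOrdering (G : Type*) [Group G] where
  lt : G → G → Prop
  irrefl : ∀ g, ¬ lt g g
  trans : ∀ f g h, lt f g → lt g h → lt f h
  total : ∀ g h, lt g h ∨ g = h ∨ lt h g
  mul_left : ∀ f g h, lt g h → lt (f * g) (f * h)

namespace LeftOrdering

variable {G : Type*} [Group G]

/-- The positive cone `{g | 1 < g}`. -/
def pos (o : LeftOrdering G) : Set G := {g | o.lt 1 g}

/-- The signs of the non-trivial elements, as a point of `{+,-}^(G - {1})`. -/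
noncomputable def sign (o : LeftOrdering G) : {g : G // g ≠ 1} → Bool :=
  open Classical in fun g => decide (o.lt 1 (g : G))

/-- The topology of `LO(G)`: the subspace topology from the product `{+,-}^(G - {1})` of
discrete two-point spaces. -/
noncomputable instance : TopologicalSpace (LeftOrdering G) :=
  TopologicalSpace.induced sign inferInstance

/-- An isolated ordering is an isolated point of `LO(G)`. -/
def IsIsolated (o : LeftOrdering G) : Prop := IsOpen ({o} : Set (LeftOrdering G))

/-- The right action of `G` on left orderings: `x < x'` in `o.conj g` iff `x g < x' g` in `o`. -/
def conj (o : LeftOrdering G) (g : G) : LeftOrdering G where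
  lt x x' := o.lt (x * g) (x' * g)
  irrefl x := o.irrefl (x * g)
  trans x y z := o.trans (x * g) (y * g) (z * g)
  total x y := by simpa using o.total (x * g) (y * g)
  mul_left f x y h := by simpa [mul_assoc] using o.mul_left f (x * g) (y * g) h

/-- The restriction of a left ordering to a subgroup. -/
def restrict (o : LeftOrdering G) (H : Subgroup G) : LeftOrdering H where
  lt x y := o.lt (x : G) (y : G)
  irrefl x := o.irrefl (x : G)
  trans x y z := o.trans (x : G) (y : G) (z : G)
  total x y := by simpa using o.total (x : G) (y : G)
  mul_left f x y h := by simpa using o.mul_left (f : G) (x : G) (y : G) h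

/-- A subgroup is convex if it contains everything lying between two of its elements. -/
def IsConvex (o : LeftOrdering G) (H : Subgroup G) : Prop :=
  ∀ h ∈ H, ∀ h' ∈ H, ∀ g : G, o.lt h g → o.lt g h' → g ∈ H

/-- Conradian orderings: `g < f g ^ k` for all positive `f`, `g` and all `k ≥ 2`. -/
def IsConradian (o : LeftOrdering G) : Prop :=
  ∀ f g : G, o.lt 1 f → o.lt 1 g → ∀ k : ℕ, 2 ≤ k → o.lt g (f * g ^ k)

/-- `H` is the Conradian soul: the largest convex subgroup on which the ordering is Conradian. -/
def IsConradianSoul (o : LeftOrdering G) (H : Subgroup G) : Prop :=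
  IsGreatest {K : Subgroup G | o.IsConvex K ∧ (o.restrict K).IsConradian} H

end LeftOrdering

/-! ### Words and the monoids defined by an ordered finite generating set -/

section Words

variable {G : Type*} [Group G] {k : ℕ}

/-- The element represented by a word on `S ∪ S⁻¹`; the letter `(i, true)` stands for `s i` and
`(i, false)` for `(s i)⁻¹`. -/
def wordValue (s : Fin k → G) (w : List (Fin k × Bool)) : G :=
  (w.map fun p => if p.2 then s p.1 else (s p.1)⁻¹).prod

/-- A word is `i`-positive if it contains the letter `s i`, but neither `(s i)⁻¹` nor any
`(s j)^±1` with `j < i`. -/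
def IsPositiveWord (i : Fin k) (w : List (Fin k × Bool)) : Prop :=
  (i, true) ∈ w ∧ (i, false) ∉ w ∧ ∀ j < i, ∀ e : Bool, (j, e) ∉ w

/-- The `σ(S)`-positive elements: those represented by an `i`-positive word for some `i`. -/
def sigmaPositive (s : Fin k → G) : Set G :=
  {g | ∃ (i : Fin k) (w : List (Fin k × Bool)), IsPositiveWord i w ∧ wordValue s w = g}

/-- The word positive elements: those represented by a non-empty product of generators. (A
positive cone does not contain `1`, so the empty word is left out.) -/
def wordPositive (s : Fin k → G) : Set G :=
  (Subsemigroup.closure (Set.range s) : Set G)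

/-- `S` is a generating set and `o` is the Dehornoy-like ordering that it defines. -/
def IsDehornoyLike (s : Fin k → G) (o : LeftOrdering G) : Prop :=
  Subgroup.closure (Set.range s) = ⊤ ∧ o.pos = sigmaPositive s

/-- `A` is a generating set and `o` is the isolated ordering that it defines. -/
def DefinesIsolated (s : Fin k → G) (o : LeftOrdering G) : Prop :=
  Subgroup.closure (Set.range s) = ⊤ ∧ o.pos = wordPositive s ∧ o.IsIsolated

end Words

/-! ### The groups `⟨x, y | x ^ m = y ^ n⟩` -/

/-- The group `⟨x, y | x ^ m = y ^ n⟩`. -/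
abbrev TorusGroup (m n : ℕ) : Type :=
  PresentedGroup
    ({FreeGroup.of 0 ^ m * (FreeGroup.of 1 ^ n)⁻¹} : Set (FreeGroup (Fin 2)))

namespace TorusGroup

variable (m n : ℕ)

def x : TorusGroup m n := PresentedGroup.of 0

def y : TorusGroup m n := PresentedGroup.of 1

def s₁ : TorusGroup m n := x m n * y m n * x m n ^ (-(m : ℤ) + 1)

def s₂ : TorusGroup m n := x m n ^ ((m : ℤ) - 1) * (y m n)⁻¹

def a : TorusGroup m n := x m n

def b : TorusGroup m n := y m n * x m n ^ (-(m : ℤ) + 1)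

/-- The ordered generating set `S = {s₁, s₂}`. -/
def S : Fin 2 → TorusGroup m n := ![s₁ m n, s₂ m n]

/-- The ordered generating set `A = {a, b}`. -/
def A : Fin 2 → TorusGroup m n := ![a m n, b m n]

end TorusGroup

/-! ### Orderings determined by a cone relative to a cyclic subgroup -/

namespace LeftOrdering

variable {G : Type*} [Group G]

/-! Both orderings come from one set `Q = halfCone a b`, the elements with a word in `a`, `b`, `b⁻¹`
that contains `a`. Since `s₁ = a b` and `s₂ = b⁻¹`, the cone of `D` is `Q` together with the
positive powers of `b⁻¹`, and that of `A` is `Q` together with the positive powers of `b`. The two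
orderings differ only by a flip on the convex subgroup `⟨b⟩`, so most of the argument concerns `Q`
alone (`IsRelCone`).

That these are cones needs two facts. First, `1 ∉ Q`: `G` acts on the line so that `b` fixes a point
which `a` moves up (`exists_action`, `one_notMem_halfCone`). Second, every element or its inverse is
a product of `a`'s and `b`'s: with `Δ = x ^ m` central, this is read off from normal forms in the
amalgam (`mem_closure_or_inv_mem_closure`).

The remaining properties use the relation `a = b (a ^ (m-1) b) ^ (n-1)`. It puts `a⁻¹ b⁻¹ a` and `a
b⁻¹ a⁻¹` in `Q`. The latter yields a failure of the Conradian condition on `G`, valid for both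
orderings; the former makes the conjugates of `D` by `b ^ i a` converge to `D`. Finite generation of
a cone forces isolation, which handles `A` directly and `D` by contraposition. -/

theorem lt_iff (o : LeftOrdering G) (g h : G) : o.lt g h ↔ g⁻¹ * h ∈ o.pos := by
  constructor
  · intro H
    simpa [pos] using o.mul_left g⁻¹ g h H
  · intro H
    simpa [pos] using o.mul_left g 1 (g⁻¹ * h) H

theorem ext_pos {o o' : LeftOrdering G} (h : o.pos = o'.pos) : o = o' := by
  ext g g'
  rw [lt_iff, lt_iff, h]

theorem one_notMem_pos (o : LeftOrdering G) : (1 : G) ∉ o.pos := o.irrefl 1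

theorem mul_mem_pos (o : LeftOrdering G) {g h : G} (hg : g ∈ o.pos) (hh : h ∈ o.pos) :
    g * h ∈ o.pos :=
  o.trans 1 g (g * h) hg (by simpa using o.mul_left g 1 h hh)

theorem inv_mem_pos_of_notMem (o : LeftOrdering G) {g : G} (h1 : g ≠ 1) (hg : g ∉ o.pos) :
    g⁻¹ ∈ o.pos := by
  rcases o.total 1 g with h | h | h
  · exact absurd h hg
  · exact absurd h.symm h1
  · simpa [pos] using o.mul_left g⁻¹ g 1 h

theorem inv_notMem_pos (o : LeftOrdering G) {g : G} (hg : g ∈ o.pos) : g⁻¹ ∉ o.pos := fun h =>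
  o.one_notMem_pos (by simpa using o.mul_mem_pos hg h)

theorem eq_of_pos_subset {o o' : LeftOrdering G} (h : o.pos ⊆ o'.pos) : o = o' := by
  refine ext_pos (h.antisymm fun g hg => ?_)
  by_contra hn
  have h1 : g ≠ 1 := fun h => o'.one_notMem_pos (h ▸ hg)
  exact o'.inv_notMem_pos hg (h (o.inv_mem_pos_of_notMem h1 hn))

theorem mem_pos_conj (o : LeftOrdering G) (g u : G) :
    u ∈ (o.conj g).pos ↔ g⁻¹ * u * g ∈ o.pos := by
  show o.lt (1 * g) (u * g) ↔ _
  rw [lt_iff]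
  simp [mul_assoc]

theorem sign_eq_true (o : LeftOrdering G) (g : {g : G // g ≠ 1}) :
    o.sign g = true ↔ (g : G) ∈ o.pos := by
  simp [sign, pos]

/-- The left ordering with a given positive cone. -/
def ofCone (P : Set G) (h1 : (1 : G) ∉ P) (hmul : ∀ g ∈ P, ∀ h ∈ P, g * h ∈ P)
    (htot : ∀ g, g ∈ P ∨ g = 1 ∨ g⁻¹ ∈ P) : LeftOrdering G where
  lt g h := g⁻¹ * h ∈ P
  irrefl g := by simpa using h1
  trans f g h hfg hgh := by simpa [mul_assoc] using hmul _ hfg _ hgh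
  total g h := by simpa [inv_mul_eq_one] using htot (g⁻¹ * h)
  mul_left f g h H := by simpa [mul_assoc] using H

theorem pos_ofCone (P : Set G) (h1 hmul htot) : (ofCone (G := G) P h1 hmul htot).pos = P := by
  ext g
  simp [ofCone, pos]

/-! ### Finitely generated cones, isolated points and limits. -/

theorem mem_pos_or_eq_one (o : LeftOrdering G) {F : Set G} (hF : F ⊆ o.pos) {g : G}
    (hg : g ∈ Submonoid.closure F) : g ∈ o.pos ∨ g = 1 := by
  induction hg using Submonoid.closure_induction with
  | mem x hx => exact Or.inl (hF hx)
  | one => exact Or.inr rfl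
  | mul x y _ _ hx hy =>
    rcases hx with hx | rfl
    · rcases hy with hy | rfl
      · exact Or.inl (o.mul_mem_pos hx hy)
      · simpa using Or.inl hx
    · simpa using hy

/-- An ordering whose positive cone is generated by a finite set is isolated. -/
theorem isIsolated_of_finite (o : LeftOrdering G) {F : Set G} (hF : F.Finite) (hpos : F ⊆ o.pos)
    (hgen : o.pos ⊆ Submonoid.closure F) : o.IsIsolated := by
  have key : ({o} : Set (LeftOrdering G)) =
      ⋂ g ∈ F, {o' : LeftOrdering G | g ∈ o'.pos} := by
    ext o'
    simp only [Set.mem_singleton_iff, Set.mem_iInter, Set.mem_ofPred_eq]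
    refine ⟨fun h g hg => h ▸ hpos hg, fun h => (eq_of_pos_subset fun g hg => ?_).symm⟩
    exact (o'.mem_pos_or_eq_one h (hgen hg)).resolve_right
      fun h => o.one_notMem_pos (h ▸ hg)
  rw [IsIsolated, key]
  refine hF.isOpen_biInter fun g hg => ?_
  have hg1 : g ≠ 1 := fun h => o.one_notMem_pos (h ▸ hpos hg)
  have : {o' : LeftOrdering G | g ∈ o'.pos} =
      (fun o' : LeftOrdering G => o'.sign ⟨g, hg1⟩) ⁻¹' {true} := by
    ext o'
    simp [sign_eq_true]
  rw [this]
  have hc : Continuous (sign : LeftOrdering G → _) := continuous_induced_dom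
  exact (isOpen_discrete _).preimage ((continuous_apply _).comp hc)

theorem not_fg_of_not_isIsolated (o : LeftOrdering G) (h : ¬ o.IsIsolated) :
    ¬ (Submonoid.closure o.pos).FG := by
  rintro ⟨S, hS⟩
  refine h (o.isIsolated_of_finite (F := (S : Set G) \ {1}) (S.finite_toSet.sdiff) ?_ ?_)
  · rintro g ⟨hg, hg1⟩
    have : g ∈ Submonoid.closure o.pos := hS ▸ Submonoid.subset_closure hg
    exact (o.mem_pos_or_eq_one subset_rfl this).resolve_right hg1
  · rw [Submonoid.closure_sdiff_singleton_one, hS]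
    exact Submonoid.subset_closure

theorem not_isIsolated_of_accPt (o : LeftOrdering G) {C : Set (LeftOrdering G)}
    (h : AccPt o (𝓟 C)) : ¬ o.IsIsolated := by
  intro ho
  rw [accPt_iff_frequently] at h
  obtain ⟨y, hy, hy'⟩ := (h.and_eventually (ho.mem_nhds rfl)).exists
  exact hy.1 hy'

/-- Only positive elements need testing: a negative element has a positive inverse, which fixes its
sign too. -/
theorem tendsto_of_eventually {ι : Type*} {l : Filter ι} (u : ι → LeftOrdering G)
    (o : LeftOrdering G) (h : ∀ g ∈ o.pos, ∀ᶠ i in l, g ∈ (u i).pos) : Tendsto u l (𝓝 o) := by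
  rw [nhds_induced, tendsto_comap_iff, tendsto_pi_nhds]
  intro g
  refine tendsto_nhds_of_eventually_eq ?_
  by_cases hg : (g : G) ∈ o.pos
  · filter_upwards [h g hg] with i hi
    rw [(sign_eq_true _ _).2 hg]
    exact (sign_eq_true _ _).2 hi
  · filter_upwards [h _ (o.inv_mem_pos_of_notMem g.2 hg)] with i hi
    have hi' : (g : G) ∉ (u i).pos := fun h => (u i).inv_notMem_pos h hi
    rw [← sign_eq_true, Bool.not_eq_true] at hg hi'
    exact hi'.trans hg.symm

end LeftOrdering

/-- `Q` is the set of positive elements outside the convex cyclic subgroup generated by `b`. -/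
structure IsRelCone {G : Type*} [Group G] (Q : Set G) (b : G) : Prop where
  mul : ∀ g ∈ Q, ∀ h ∈ Q, g * h ∈ Q
  zpow_mul : ∀ (k : ℤ), ∀ g ∈ Q, b ^ k * g ∈ Q
  mul_zpow : ∀ (k : ℤ), ∀ g ∈ Q, g * b ^ k ∈ Q
  one_notMem : (1 : G) ∉ Q
  trichotomy : ∀ g : G, g ∈ Q ∨ g⁻¹ ∈ Q ∨ g ∈ Subgroup.zpowers b
  pow_ne_one : ∀ k : ℕ, 0 < k → b ^ k ≠ 1

/-- The elements of `Q` and the positive powers of `b`. -/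
def relCone {G : Type*} [Group G] (Q : Set G) (b : G) : Set G :=
  Q ∪ {g | ∃ k : ℕ, 0 < k ∧ g = b ^ k}

namespace IsRelCone

open LeftOrdering

variable {G : Type*} [Group G] {Q : Set G} {b : G}

/-- The conditions on `Q` see `b` only through `⟨b⟩`, so the same `Q` serves `A` (with `b`) and `D`
(with `b⁻¹`). -/
theorem inv (hQ : IsRelCone Q b) : IsRelCone Q b⁻¹ where
  mul := hQ.mul
  zpow_mul k g hg := by simpa using hQ.zpow_mul (-k) g hg
  mul_zpow k g hg := by simpa using hQ.mul_zpow (-k) g hg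
  one_notMem := hQ.one_notMem
  trichotomy := by simpa using hQ.trichotomy
  pow_ne_one := by simpa using hQ.pow_ne_one

theorem zpow_notMem (hQ : IsRelCone Q b) (k : ℤ) : b ^ k ∉ Q := fun h =>
  hQ.one_notMem (by simpa using hQ.zpow_mul (-k) _ h)

/-- The ordering with positive cone `relCone Q b`. -/
def ordering (hQ : IsRelCone Q b) : LeftOrdering G :=
  ofCone (relCone Q b)
    (by
      rintro (h | ⟨k, hk, h⟩)
      · exact hQ.one_notMem h
      · exact hQ.pow_ne_one k hk h.symm)
    (by
      rintro g (hg | ⟨k, hk, rfl⟩) h (hh | ⟨l, hl, rfl⟩)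
      · exact Or.inl (hQ.mul _ hg _ hh)
      · exact Or.inl (by simpa using hQ.mul_zpow l _ hg)
      · exact Or.inl (by simpa using hQ.zpow_mul k _ hh)
      · exact Or.inr ⟨k + l, by omega, (pow_add _ _ _).symm⟩)
    (by
      intro g
      rcases hQ.trichotomy g with h | h | ⟨k, rfl⟩
      · exact Or.inl (Or.inl h)
      · exact Or.inr (Or.inr (Or.inl h))
      · rcases lt_trichotomy k 0 with hk | rfl | hk
        · refine Or.inr (Or.inr (Or.inr ⟨k.natAbs, by omega, ?_⟩))
          show (b ^ k)⁻¹ = _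
          rw [← zpow_natCast, ← zpow_neg]
          congr 1
          omega
        · simp
        · refine Or.inl (Or.inr ⟨k.natAbs, by omega, ?_⟩)
          show b ^ k = _
          rw [← zpow_natCast]
          congr 1
          omega)

theorem pos_ordering (hQ : IsRelCone Q b) : hQ.ordering.pos = relCone Q b := pos_ofCone _ _ _ _

/-! ### Convex subgroups and the Conradian soul. -/

theorem isConvex_zpowers (hQ : IsRelCone Q b) : hQ.ordering.IsConvex (Subgroup.zpowers b) := by
  rintro _ ⟨k, rfl⟩ _ ⟨l, rfl⟩ g h1 h2
  rw [lt_iff, pos_ordering] at h1 h2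
  rcases h1 with h1 | ⟨i, -, h1⟩
  · rcases h2 with h2 | ⟨j, -, h2⟩
    · have := hQ.mul _ h1 _ h2
      refine absurd ?_ (hQ.zpow_notMem (-k + l))
      simpa [zpow_add] using this
    · refine ⟨l - j, ?_⟩
      simp only [zpow_sub, zpow_natCast, ← h2]
      simp
  · refine ⟨k + i, ?_⟩
    simp only [zpow_add, zpow_natCast, ← h1]
    simp

/-- `b` is the least positive element, so a non-trivial convex subgroup contains it. If the subgroup
also meets `Q`, stripping a power of `b` leaves some `a p`; then `a` lies below `a p`, or differs
from it by a power of `b`, and both generators are captured. -/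
theorem isConvex_iff (hQ : IsRelCone Q b) {a : G} (htop : Subgroup.closure {a, b} = ⊤)
    (ha : a ∈ Q)
    (hfact : ∀ q ∈ Q, ∃ k : ℤ, ∃ p, (p ∈ Q ∨ p ∈ Subgroup.zpowers b) ∧ q = b ^ k * (a * p))
    (H : Subgroup G) :
    hQ.ordering.IsConvex H ↔ H = ⊥ ∨ H = Subgroup.zpowers b ∨ H = ⊤ := by
  constructor
  · intro hH
    by_cases hbot : H = ⊥
    · exact Or.inl hbot
    right
    have hbet : ∀ g h, g ∈ relCone Q b → g⁻¹ * h ∈ relCone Q b → h ∈ H → g ∈ H := by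
      intro g h hg hgh hh
      refine hH 1 H.one_mem h hh g ?_ ?_
      · rw [lt_iff, pos_ordering]
        simpa using hg
      · rw [lt_iff, pos_ordering]
        exact hgh
    have hbpos : b ∈ relCone Q b := Or.inr ⟨1, one_pos, by simp⟩
    have hb_of_Q : ∀ q ∈ Q, q ∈ H → b ∈ H := fun q hq hqH =>
      hbet b q hbpos (Or.inl (by simpa using hQ.zpow_mul (-1) q hq)) hqH
    have hbH : b ∈ H := by
      obtain ⟨g, hg, hg1⟩ := H.bot_or_exists_ne_one.resolve_left hbot
      have hcone : ∀ g ∈ H, g ∈ relCone Q b → b ∈ H := by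
        rintro g hg (hq | ⟨k, hk, rfl⟩)
        · exact hb_of_Q g hq hg
        · obtain ⟨j, rfl⟩ : ∃ j, k = j + 1 := ⟨k - 1, by omega⟩
          rcases Nat.eq_zero_or_pos j with rfl | hj
          · simpa using hg
          · exact hbet b _ hbpos (Or.inr ⟨j, hj, by simp [pow_succ']⟩) hg
      by_cases hgp : g ∈ hQ.ordering.pos
      · exact hcone g hg (hQ.pos_ordering ▸ hgp)
      · exact hcone g⁻¹ (H.inv_mem hg)
          (hQ.pos_ordering ▸ hQ.ordering.inv_mem_pos_of_notMem hg1 hgp)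
    by_cases hQH : ∃ q ∈ Q, q ∈ H
    · right
      obtain ⟨q, hq, hqH⟩ := hQH
      obtain ⟨k, p, hp, rfl⟩ := hfact q hq
      have hap : a * p ∈ H := by
        simpa using H.mul_mem (H.zpow_mem hbH (-k)) hqH
      have haH : a ∈ H := by
        rcases hp with hp | ⟨l, rfl⟩
        · exact hbet a _ (Or.inl ha) (Or.inl (by simpa using hp)) hap
        · simpa using H.mul_mem hap (H.zpow_mem hbH (-l))
      rw [eq_top_iff, ← htop, Subgroup.closure_le]
      rintro _ (rfl | rfl)
      exacts [haH, hbH]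
    · left
      refine le_antisymm (fun g hg => ?_) (by simpa using hbH)
      rcases hQ.trichotomy g with h | h | h
      · exact absurd ⟨g, h, hg⟩ hQH
      · exact absurd ⟨_, h, H.inv_mem hg⟩ hQH
      · exact h
  · rintro (rfl | rfl | rfl)
    · intro h hh h' hh' g h1 h2
      rw [Subgroup.mem_bot] at hh hh'
      subst hh hh'
      exact absurd (hQ.ordering.trans _ _ _ h1 h2) (hQ.ordering.irrefl _)
    · exact hQ.isConvex_zpowers
    · intro _ _ _ _ _ _ _
      trivial

theorem isConradian_restrict_zpowers (hQ : IsRelCone Q b) :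
    (hQ.ordering.restrict (Subgroup.zpowers b)).IsConradian := by
  have aux : ∀ f : Subgroup.zpowers b,
      (hQ.ordering.restrict (Subgroup.zpowers b)).lt 1 f → ∃ i : ℕ, 0 < i ∧ (f : G) = b ^ i := by
    rintro ⟨_, k, rfl⟩ h
    have h' : b ^ k ∈ hQ.ordering.pos := h
    rw [pos_ordering] at h'
    exact h'.resolve_left (hQ.zpow_notMem k)
  intro f g hf hg k hk
  obtain ⟨i, hi, hf⟩ := aux f hf
  obtain ⟨j, hj, hg⟩ := aux g hg
  show hQ.ordering.lt (g : G) ((f : G) * (g : G) ^ k)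
  rw [hf, hg, lt_iff, pos_ordering]
  obtain ⟨k, rfl⟩ : ∃ l, k = l + 1 := ⟨k - 1, by omega⟩
  refine Or.inr ⟨i + j * k, by omega, ?_⟩
  rw [inv_mul_eq_iff_eq_mul, ← pow_mul, ← pow_add, ← pow_add]
  congr 1
  ring

/-- The only larger convex candidate is `G`, and `f g ^ 2 < g` excludes it. -/
theorem isConradianSoul_zpowers (hQ : IsRelCone Q b)
    (hconv : ∀ H : Subgroup G, hQ.ordering.IsConvex H →
      H = ⊥ ∨ H = Subgroup.zpowers b ∨ H = ⊤)
    {f g : G} (hf : f ∈ Q) (hg : g ∈ Q) (hfg : (g⁻¹ * (f * g ^ 2))⁻¹ ∈ Q) :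
    hQ.ordering.IsConradianSoul (Subgroup.zpowers b) := by
  refine ⟨⟨hQ.isConvex_zpowers, hQ.isConradian_restrict_zpowers⟩, ?_⟩
  rintro H ⟨hH, hH'⟩
  rcases hconv H hH with rfl | rfl | rfl
  · exact bot_le
  · exact le_rfl
  · have hpos : ∀ q ∈ Q, q ∈ hQ.ordering.pos := fun q hq => hQ.pos_ordering ▸ Or.inl hq
    have := hH' ⟨f, trivial⟩ ⟨g, trivial⟩ (hpos f hf) (hpos g hg) 2 le_rfl
    have h2 : hQ.ordering.lt g (f * g ^ 2) := this
    rw [lt_iff] at h2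
    exact absurd (hpos _ hfg) (hQ.ordering.inv_notMem_pos h2)

end IsRelCone

/-! ### Words in which `a` occurs only positively -/

section HalfCone

variable {G : Type*} [Group G]

/-- The monoid generated by `a`, `b` and `b⁻¹`. -/
def halfMonoid (a b : G) : Submonoid G := Submonoid.closure {a, b, b⁻¹}

/-- The elements represented by a word in `a`, `b`, `b⁻¹` that contains `a`. -/
def halfCone (a b : G) : Set G := {g | ∃ k : ℤ, ∃ p ∈ halfMonoid a b, g = b ^ k * (a * p)}

variable {a b : G}

theorem left_mem_halfMonoid : a ∈ halfMonoid a b := Submonoid.subset_closure (by simp)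

theorem zpow_mem_halfMonoid (k : ℤ) : b ^ k ∈ halfMonoid a b := by
  have hb : b ∈ halfMonoid a b := Submonoid.subset_closure (by simp)
  have hb' : b⁻¹ ∈ halfMonoid a b := Submonoid.subset_closure (by simp)
  cases k with
  | ofNat k => simpa using pow_mem hb k
  | negSucc k => simpa using pow_mem hb' (k + 1)

theorem left_mem_halfCone : a ∈ halfCone a b := ⟨0, 1, one_mem _, by simp⟩

theorem halfCone_subset_halfMonoid {g : G} (hg : g ∈ halfCone a b) : g ∈ halfMonoid a b := by
  obtain ⟨k, p, hp, rfl⟩ := hg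
  exact mul_mem (zpow_mem_halfMonoid k) (mul_mem left_mem_halfMonoid hp)

theorem halfCone_mul_mem {g h : G} (hg : g ∈ halfCone a b) (hh : h ∈ halfMonoid a b) :
    g * h ∈ halfCone a b := by
  obtain ⟨k, p, hp, rfl⟩ := hg
  exact ⟨k, p * h, mul_mem hp hh, by simp [mul_assoc]⟩

theorem zpow_mul_mem_halfCone (k : ℤ) {g : G} (hg : g ∈ halfCone a b) :
    b ^ k * g ∈ halfCone a b := by
  obtain ⟨l, p, hp, rfl⟩ := hg
  exact ⟨k + l, p, hp, by simp [zpow_add, mul_assoc]⟩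

theorem mem_halfMonoid_iff {g : G} :
    g ∈ halfMonoid a b ↔ g ∈ halfCone a b ∨ g ∈ Subgroup.zpowers b := by
  constructor
  · intro hg
    induction hg using Submonoid.closure_induction_left with
    | one => exact Or.inr (one_mem _)
    | mul_left x hx y hy ih =>
      have hz : ∀ k : ℤ, b ^ k * y ∈ halfCone a b ∨ b ^ k * y ∈ Subgroup.zpowers b := fun k =>
        ih.imp (zpow_mul_mem_halfCone k) (mul_mem ⟨k, rfl⟩)
      rcases hx with rfl | rfl | rfl
      · exact Or.inl ⟨0, y, hy, by simp⟩
      · simpa using hz 1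
      · simpa using hz (-1)
  · rintro (h | ⟨k, rfl⟩)
    · exact halfCone_subset_halfMonoid h
    · exact zpow_mem_halfMonoid k

theorem mul_halfCone_mem {g h : G} (hg : g ∈ halfMonoid a b) (hh : h ∈ halfCone a b) :
    g * h ∈ halfCone a b := by
  rcases mem_halfMonoid_iff.1 hg with hg | ⟨k, rfl⟩
  · exact halfCone_mul_mem hg (halfCone_subset_halfMonoid hh)
  · exact zpow_mul_mem_halfCone k hh

theorem closure_le_halfMonoid : Submonoid.closure {a, b} ≤ halfMonoid a b :=
  Submonoid.closure_mono (by grind)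

theorem isRelCone_halfCone (h1 : (1 : G) ∉ halfCone a b) (hb : ∀ k : ℕ, 0 < k → b ^ k ≠ 1)
    (htot : ∀ g : G, g ∈ Submonoid.closure {a, b} ∨ g⁻¹ ∈ Submonoid.closure {a, b}) :
    IsRelCone (halfCone a b) b where
  mul _ hg _ hh := halfCone_mul_mem hg (halfCone_subset_halfMonoid hh)
  zpow_mul k _ hg := zpow_mul_mem_halfCone k hg
  mul_zpow k _ hg := halfCone_mul_mem hg (zpow_mem_halfMonoid k)
  one_notMem := h1
  trichotomy g := by
    rcases htot g with h | h
    · rcases mem_halfMonoid_iff.1 (closure_le_halfMonoid h) with h | h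
      · exact Or.inl h
      · exact Or.inr (Or.inr h)
    · rcases mem_halfMonoid_iff.1 (closure_le_halfMonoid h) with h | h
      · exact Or.inr (Or.inl h)
      · exact Or.inr (Or.inr (by simpa using h))
  pow_ne_one := hb

theorem subsemigroup_closure_eq_relCone (h1 : (1 : G) ∉ halfCone a b)
    (htot : ∀ g : G, g ∈ Submonoid.closure {a, b} ∨ g⁻¹ ∈ Submonoid.closure {a, b}) :
    (Subsemigroup.closure {a, b} : Set G) = relCone (halfCone a b) b := by
  have hone : ∀ g ∈ Submonoid.closure {a, b}, g = 1 ∨ g ∈ Subsemigroup.closure {a, b} := by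
    intro g hg
    induction hg using Submonoid.closure_induction with
    | mem x hx => exact Or.inr (Subsemigroup.subset_closure hx)
    | one => exact Or.inl rfl
    | mul x y _ _ hx hy =>
      rcases hx with rfl | hx
      · simpa using hy
      · rcases hy with rfl | hy
        · simpa using Or.inr hx
        · exact Or.inr (mul_mem hx hy)
  apply Set.Subset.antisymm
  · intro g hg
    induction hg using Subsemigroup.closure_induction with
    | mem x hx =>
      rcases hx with rfl | rfl
      · exact Or.inl left_mem_halfCone
      · exact Or.inr ⟨1, one_pos, by simp⟩
    | mul x y _ _ hx hy =>
      rcases hx with hx | ⟨k, hk, rfl⟩ <;> rcases hy with hy | ⟨l, hl, rfl⟩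
      · exact Or.inl (halfCone_mul_mem hx (halfCone_subset_halfMonoid hy))
      · exact Or.inl (halfCone_mul_mem hx (by simpa using zpow_mem_halfMonoid (l : ℤ)))
      · exact Or.inl (by simpa using zpow_mul_mem_halfCone (k : ℤ) hy)
      · exact Or.inr ⟨k + l, by omega, (pow_add _ _ _).symm⟩
  · rintro g (hg | ⟨k, hk, rfl⟩)
    · rcases htot g with h | h
      · exact (hone g h).resolve_left fun h => h1 (h ▸ hg)
      -- If `g⁻¹` were a product of generators, then `1 = g g⁻¹` would lie in the half cone.
      · have := halfCone_mul_mem hg (closure_le_halfMonoid h)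
        exact absurd (by simpa using this) h1
    · obtain ⟨j, rfl⟩ : ∃ j, k = j + 1 := ⟨k - 1, by omega⟩
      clear hk
      have hb : b ∈ Subsemigroup.closure {a, b} := Subsemigroup.subset_closure (by simp)
      induction j with
      | zero => simpa using hb
      | succ j ih => rw [pow_succ]; exact mul_mem ih hb

/-- If `b` fixes a point and `a` moves it up, then no word in `a`, `b`, `b⁻¹` that contains `a` is
trivial. -/
theorem one_notMem_halfCone {Ω : Type*} [LinearOrder Ω] (φ : G →* (Ω ≃o Ω)) (p : Ω)
    (hb : φ b p = p) (ha : p < φ a p) : (1 : G) ∉ halfCone a b := by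
  have hb' : φ b⁻¹ p = p := by
    rw [map_inv]
    exact (φ b).symm_apply_eq.2 hb.symm
  have hle : ∀ g ∈ halfMonoid a b, p ≤ φ g p := by
    intro g hg
    induction hg using Submonoid.closure_induction_left with
    | one => simp
    | mul_left x hx y hy ih =>
      have : φ x p ≤ φ (x * y) p := by
        rw [map_mul]
        exact (φ x).monotone ih
      refine le_trans ?_ this
      rcases hx with rfl | rfl | rfl
      exacts [ha.le, hb.ge, hb'.ge]
  rintro ⟨k, g, hg, h⟩
  have h2 : p < φ (a * g) p := by
    rw [map_mul]
    exact ha.trans_le ((φ a).monotone (hle g hg))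
  have h5 : p < φ (b ^ k) (φ (a * g) p) :=
    (hle _ (zpow_mem_halfMonoid k)).trans_lt ((φ (b ^ k)).strictMono h2)
  rw [← RelIso.mul_apply, ← map_mul, ← h] at h5
  simp at h5

end HalfCone

/-! ### Alternating words in the amalgam `⟨x, y | x ^ m = y ^ n⟩` -/

section Alternating

variable {G : Type*} [Group G]

/-- `IsAlternating x y m n g t s` says that `g` is an alternating product of powers `x ^ i` with
`0 < i < m` and `y ^ j` with `0 < j < n`, in which a power of `y` is followed by a power of `x`
exactly `t` times; `s` tells whether the product starts with a power of `x`. -/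
inductive IsAlternating (x y : G) (m n : ℕ) : G → ℕ → Bool → Prop
  | x_pow (i : ℕ) (hi : i + 1 < m) : IsAlternating x y m n (x ^ (i + 1)) 0 true
  | y_pow (j : ℕ) (hj : j + 1 < n) : IsAlternating x y m n (y ^ (j + 1)) 0 false
  | x_pow_mul (i : ℕ) (hi : i + 1 < m) (g : G) (t : ℕ) (h : IsAlternating x y m n g t false) :
      IsAlternating x y m n (x ^ (i + 1) * g) t true
  | y_pow_mul (j : ℕ) (hj : j + 1 < n) (g : G) (t : ℕ) (h : IsAlternating x y m n g t true) :
      IsAlternating x y m n (y ^ (j + 1) * g) (t + 1) false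

variable {x y b : G} {m n : ℕ}

theorem commute_pow_of_closure (hxy : x ^ m = y ^ n) (htop : Subgroup.closure {x, y} = ⊤) (g : G) :
    Commute (x ^ m) g := by
  have hg : g ∈ Subgroup.closure {x, y} := htop ▸ Subgroup.mem_top g
  induction hg using Subgroup.closure_induction with
  | mem z hz =>
    rcases hz with rfl | rfl
    · exact (Commute.refl z).pow_left m
    · rw [hxy]
      exact (Commute.refl z).pow_left n
  | one => exact Commute.one_right _
  | mul z w _ _ hz hw => exact hz.mul_right hw
  | inv z _ hz => exact hz.inv_right

/-- Since `y x = b x ^ m`, each junction of a `y`-power with a following `x`-power releases one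
central factor. A leading `x` is kept aside to feed the next junction on its left. -/
theorem IsAlternating.exists_eq_mul_pow (hm : 2 ≤ m) (hc : ∀ g, Commute (x ^ m) g)
    (hb : b * x ^ (m - 1) = y) {g : G} {t : ℕ} {s : Bool} (h : IsAlternating x y m n g t s) :
    ∃ p ∈ Submonoid.closure {x, b}, g = (if s then x * p else p) * (x ^ m) ^ t := by
  have hx : x ∈ Submonoid.closure {x, b} := Submonoid.subset_closure (by simp)
  have hbm : b ∈ Submonoid.closure {x, b} := Submonoid.subset_closure (by simp)
  have hy : y ∈ Submonoid.closure {x, b} := hb ▸ mul_mem hbm (pow_mem hx _)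
  have hyx : y * x = b * x ^ m := by
    rw [← hb, mul_assoc, ← pow_succ]
    congr 2
    omega
  induction h with
  | x_pow i hi => exact ⟨x ^ i, pow_mem hx i, by simp [pow_succ']⟩
  | y_pow j hj => exact ⟨y ^ (j + 1), pow_mem hy _, by simp⟩
  | x_pow_mul i hi g t h ih =>
    obtain ⟨p, hp, rfl⟩ := ih
    exact ⟨x ^ i * p, mul_mem (pow_mem hx _) hp, by simp [pow_succ', mul_assoc]⟩
  | y_pow_mul j hj g t h ih =>
    obtain ⟨p, hp, rfl⟩ := ih
    refine ⟨y ^ j * (b * p), mul_mem (pow_mem hy _) (mul_mem hbm hp), ?_⟩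
    calc y ^ (j + 1) * ((if true then x * p else p) * (x ^ m) ^ t)
        = y ^ j * ((y * x) * p * (x ^ m) ^ t) := by simp [pow_succ, mul_assoc]
      _ = y ^ j * (b * (x ^ m * p) * (x ^ m) ^ t) := by rw [hyx]; simp [mul_assoc]
      _ = y ^ j * (b * (p * x ^ m) * (x ^ m) ^ t) := by rw [(hc p).eq]
      _ = _ := by simp [pow_succ', mul_assoc]

/-- Left complements. Each `y`-power is completed to `y ^ n`, at the cost of one central factor. The
`y` kept at the end of the complement equals `b x ^ (m - 1)`, so it absorbs a preceding `x`-power at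
no cost. -/
theorem IsAlternating.exists_mul_eq_pow (hc : ∀ g, Commute (x ^ m) g)
    (hxy : x ^ m = y ^ n) (hb : b * x ^ (m - 1) = y) {g : G} {t : ℕ} {s : Bool}
    (h : IsAlternating x y m n g t s) :
    ∃ p ∈ Submonoid.closure {x, b}, (if s then p else p * y) * g = (x ^ m) ^ (t + 1) := by
  have hx : x ∈ Submonoid.closure {x, b} := Submonoid.subset_closure (by simp)
  have hbm : b ∈ Submonoid.closure {x, b} := Submonoid.subset_closure (by simp)
  have hy : y ∈ Submonoid.closure {x, b} := hb ▸ mul_mem hbm (pow_mem hx _)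
  have hyn : ∀ j, j + 1 < n → y ^ (n - (j + 2)) * y * y ^ (j + 1) = x ^ m := by
    intro j hj
    rw [hxy, ← pow_succ, ← pow_add]
    congr 1
    omega
  induction h with
  | x_pow i hi =>
    refine ⟨x ^ (m - (i + 1)), pow_mem hx _, ?_⟩
    simp only [if_true, ← pow_add, zero_add, pow_one]
    congr 1
    omega
  | y_pow j hj =>
    exact ⟨y ^ (n - (j + 2)), pow_mem hy _, by simpa using hyn j hj⟩
  | x_pow_mul i hi g t h ih =>
    obtain ⟨p, hp, ih⟩ := ih
    refine ⟨p * (b * x ^ (m - (i + 2))), mul_mem hp (mul_mem hbm (pow_mem hx _)), ?_⟩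
    have : x ^ (m - (i + 2)) * x ^ (i + 1) = x ^ (m - 1) := by
      rw [← pow_add]
      congr 1
      omega
    calc p * (b * x ^ (m - (i + 2))) * (x ^ (i + 1) * g)
        = p * (b * (x ^ (m - (i + 2)) * x ^ (i + 1))) * g := by simp only [mul_assoc]
      _ = _ := by rw [this, hb]; simpa using ih
  | y_pow_mul j hj g t h ih =>
    obtain ⟨p, hp, ih⟩ := ih
    refine ⟨p * y ^ (n - (j + 2)), mul_mem hp (pow_mem hy _), ?_⟩
    calc p * y ^ (n - (j + 2)) * y * (y ^ (j + 1) * g)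
        = p * (y ^ (n - (j + 2)) * y * y ^ (j + 1)) * g := by simp only [mul_assoc]
      _ = x ^ m * (p * g) := by rw [hyn j hj, ← (hc p).eq, mul_assoc]
      _ = _ := by
        rw [pow_succ' _ (t + 1)]
        congr 1

/-- Normal forms: an alternating product times a power of the central element `x ^ m`. -/
def HasNormalForm (x y : G) (m n : ℕ) (g : G) : Prop :=
  (∃ k : ℤ, g = (x ^ m) ^ k) ∨
    ∃ (u : G) (t : ℕ) (s : Bool) (k : ℤ), IsAlternating x y m n u t s ∧ g = u * (x ^ m) ^ k

theorem HasNormalForm.mul_zpow {g : G} (h : HasNormalForm x y m n g) (l : ℤ) :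
    HasNormalForm x y m n (g * (x ^ m) ^ l) := by
  rcases h with ⟨k, rfl⟩ | ⟨u, t, s, k, hu, rfl⟩
  · exact Or.inl ⟨k + l, (zpow_add _ _ _).symm⟩
  · exact Or.inr ⟨u, t, s, k + l, hu, by rw [zpow_add, mul_assoc]⟩

theorem IsAlternating.hasNormalForm {g : G} {t : ℕ} {s : Bool} (h : IsAlternating x y m n g t s) :
    HasNormalForm x y m n g := Or.inr ⟨g, t, s, 0, h, by simp⟩

theorem HasNormalForm.x_mul (hm : 2 ≤ m) (hc : ∀ g, Commute (x ^ m) g) {g : G}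
    (h : HasNormalForm x y m n g) : HasNormalForm x y m n (x * g) := by
  rcases h with ⟨k, rfl⟩ | ⟨u, t, s, k, hu, rfl⟩
  · exact Or.inr ⟨_, _, _, k, .x_pow 0 (by omega), by simp⟩
  rw [← mul_assoc]
  refine HasNormalForm.mul_zpow ?_ k
  cases hu with
  | x_pow i hi =>
    rw [← pow_succ']
    rcases eq_or_ne (i + 1 + 1) m with h | h
    · exact Or.inl ⟨1, by simp [h]⟩
    · exact (IsAlternating.x_pow (i + 1) (by omega)).hasNormalForm
  | y_pow j hj => simpa using (IsAlternating.x_pow_mul 0 (by omega) _ _ (.y_pow j hj)).hasNormalForm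
  | x_pow_mul i hi g t h =>
    rw [← mul_assoc, ← pow_succ']
    rcases eq_or_ne (i + 1 + 1) m with h' | h'
    · rw [h', (hc g).eq]
      simpa using h.hasNormalForm.mul_zpow 1
    · exact (IsAlternating.x_pow_mul (i + 1) (by omega) _ _ h).hasNormalForm
  | y_pow_mul j hj g t h =>
    simpa using (IsAlternating.x_pow_mul 0 (by omega) _ _ (.y_pow_mul j hj g t h)).hasNormalForm

theorem HasNormalForm.y_mul (hn : 2 ≤ n) (hc : ∀ g, Commute (x ^ m) g) (hxy : x ^ m = y ^ n)
    {g : G} (h : HasNormalForm x y m n g) : HasNormalForm x y m n (y * g) := by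
  rcases h with ⟨k, rfl⟩ | ⟨u, t, s, k, hu, rfl⟩
  · exact Or.inr ⟨_, _, _, k, .y_pow 0 (by omega), by simp⟩
  rw [← mul_assoc]
  refine HasNormalForm.mul_zpow ?_ k
  cases hu with
  | x_pow i hi => simpa using (IsAlternating.y_pow_mul 0 (by omega) _ _ (.x_pow i hi)).hasNormalForm
  | y_pow j hj =>
    rw [← pow_succ']
    rcases eq_or_ne (j + 1 + 1) n with h | h
    · exact Or.inl ⟨1, by simp [h, hxy]⟩
    · exact (IsAlternating.y_pow (j + 1) (by omega)).hasNormalForm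
  | x_pow_mul i hi g t h =>
    simpa using (IsAlternating.y_pow_mul 0 (by omega) _ _ (.x_pow_mul i hi g t h)).hasNormalForm
  | y_pow_mul j hj g t h =>
    rw [← mul_assoc, ← pow_succ']
    rcases eq_or_ne (j + 1 + 1) n with h' | h'
    · rw [h', ← hxy, (hc g).eq]
      simpa using h.hasNormalForm.mul_zpow 1
    · exact (IsAlternating.y_pow_mul (j + 1) (by omega) _ _ h).hasNormalForm

theorem hasNormalForm_of_closure (hm : 2 ≤ m) (hn : 2 ≤ n) (hxy : x ^ m = y ^ n)
    (htop : Subgroup.closure {x, y} = ⊤) (g : G) : HasNormalForm x y m n g := by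
  have hc := commute_pow_of_closure hxy htop
  have hg : g ∈ Subgroup.closure {x, y} := htop ▸ Subgroup.mem_top g
  have hx : ∀ g, HasNormalForm x y m n g → HasNormalForm x y m n (x * g) :=
    fun g h => h.x_mul hm hc
  have hy : ∀ g, HasNormalForm x y m n g → HasNormalForm x y m n (y * g) :=
    fun g h => h.y_mul hn hc hxy
  have hpow : ∀ z : G, (∀ g, HasNormalForm x y m n g → HasNormalForm x y m n (z * g)) →
      ∀ (i : ℕ) g, HasNormalForm x y m n g → HasNormalForm x y m n (z ^ i * g) := by
    intro z hz i
    induction i with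
    | zero => simp
    | succ i ih =>
      intro g hg
      rw [pow_succ', mul_assoc]
      exact hz _ (ih g hg)
  -- Inverses of generators reduce to positive powers and a central factor.
  have hinv : ∀ (z : G) (i : ℕ), 0 < i → z ^ i = x ^ m → ∀ g,
      z⁻¹ * g = z ^ (i - 1) * (g * (x ^ m) ^ (-1 : ℤ)) := by
    intro z i hi hz g
    rw [inv_mul_eq_iff_eq_mul, ← mul_assoc, ← pow_succ', Nat.sub_add_cancel hi, hz, ← mul_assoc,
      (hc g).eq]
    simp
  induction hg using Subgroup.closure_induction_left with
  | one => exact Or.inl ⟨0, by simp⟩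
  | mul_left z hz w _ ih =>
    rcases hz with rfl | rfl
    exacts [hx _ ih, hy _ ih]
  | inv_mul_cancel z hz w _ ih =>
    rcases hz with rfl | rfl
    · rw [hinv z m (by omega) rfl]
      exact hpow _ hx _ _ (ih.mul_zpow _)
    · rw [hinv z n (by omega) hxy.symm]
      exact hpow _ hy _ _ (ih.mul_zpow _)

/-- For `u Δ ^ k` with `t` junctions, `u` is positive times `Δ ^ t` and also the inverse of a
positive element times `Δ ^ (t + 1)`. The cases `t + k ≥ 0` and `t + 1 + k ≤ 0` leave no gap. -/
theorem mem_closure_or_inv_mem_closure (hm : 2 ≤ m) (hn : 2 ≤ n) (hxy : x ^ m = y ^ n)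
    (htop : Subgroup.closure {x, y} = ⊤) (hb : b * x ^ (m - 1) = y) (g : G) :
    g ∈ Submonoid.closure {x, b} ∨ g⁻¹ ∈ Submonoid.closure {x, b} := by
  have hc := commute_pow_of_closure hxy htop
  have hx : x ∈ Submonoid.closure {x, b} := Submonoid.subset_closure (by simp)
  have hbm : b ∈ Submonoid.closure {x, b} := Submonoid.subset_closure (by simp)
  have hy : y ∈ Submonoid.closure {x, b} := hb ▸ mul_mem hbm (pow_mem hx _)
  have hΔ : ∀ k : ℤ, 0 ≤ k → (x ^ m) ^ k ∈ Submonoid.closure {x, b} := by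
    intro k hk
    lift k to ℕ using hk
    rw [zpow_natCast]
    exact pow_mem (pow_mem hx _) _
  rcases hasNormalForm_of_closure hm hn hxy htop g with ⟨k, rfl⟩ | ⟨u, t, s, k, hu, rfl⟩
  · rcases le_total 0 k with hk | hk
    · exact Or.inl (hΔ k hk)
    · rw [← zpow_neg]
      exact Or.inr (hΔ _ (by omega))
  · rcases le_or_gt 0 (t + k) with hk | hk
    · obtain ⟨p, hp, rfl⟩ := hu.exists_eq_mul_pow hm hc hb
      left
      rw [mul_assoc, ← zpow_natCast _ t, ← zpow_add]
      refine mul_mem ?_ (hΔ _ hk)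
      split_ifs
      exacts [mul_mem hx hp, hp]
    · obtain ⟨p, hp, h⟩ := hu.exists_mul_eq_pow hc hxy hb
      right
      set q := if s then p else p * y with hq
      have hqm : q ∈ Submonoid.closure {x, b} := by
        rw [hq]
        split_ifs
        exacts [hp, mul_mem hp hy]
      have hu' : u = q⁻¹ * (x ^ m) ^ ((t : ℤ) + 1) := by
        rw [eq_inv_mul_iff_mul_eq, h]
        exact_mod_cast rfl
      rw [hu', mul_assoc, ← zpow_add, mul_inv_rev, inv_inv, ← zpow_neg]
      exact mul_mem (hΔ _ (by omega)) hqm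

end Alternating

/-! ### An action on the line -/

section Action

/-- The map of the line that commutes with integer translations and is `s ↦ s / (s + K (1 - s))`
on `[0, 1)`. -/
noncomputable def floorMoebius (K t : ℝ) : ℝ :=
  ⌊t⌋ + Int.fract t / (Int.fract t + K * (1 - Int.fract t))

variable {K : ℝ}

theorem floorMoebius_denom_pos (hK : 0 < K) (t : ℝ) :
    0 < Int.fract t + K * (1 - Int.fract t) := by
  have h0 := Int.fract_nonneg t
  have h1 : 0 < 1 - Int.fract t := sub_pos.2 (Int.fract_lt_one t)
  positivity

theorem floor_floorMoebius (hK : 0 < K) (t : ℝ) : ⌊floorMoebius K t⌋ = ⌊t⌋ := by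
  have hd := floorMoebius_denom_pos hK t
  have h1 : 0 < 1 - Int.fract t := sub_pos.2 (Int.fract_lt_one t)
  rw [floorMoebius, Int.floor_intCast_add, add_eq_left, Int.floor_eq_zero_iff]
  refine ⟨div_nonneg (Int.fract_nonneg t) hd.le, (div_lt_one hd).2 ?_⟩
  have := mul_pos hK h1
  linarith

theorem fract_floorMoebius (hK : 0 < K) (t : ℝ) :
    Int.fract (floorMoebius K t) = Int.fract t / (Int.fract t + K * (1 - Int.fract t)) := by
  rw [Int.fract, floor_floorMoebius hK]
  simp [floorMoebius]

theorem floorMoebius_strictMono (hK : 0 < K) : StrictMono (floorMoebius K) := by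
  intro s t hst
  rcases (Int.floor_mono hst.le).lt_or_eq with h | h
  · refine lt_of_not_ge fun hle => ?_
    have := Int.floor_mono hle
    rw [floor_floorMoebius hK, floor_floorMoebius hK] at this
    omega
  · have hf : Int.fract s < Int.fract t := by
      rw [Int.fract, Int.fract, h]
      linarith
    rw [floorMoebius, floorMoebius, h]
    gcongr ?_ + ?_
    rw [div_lt_div_iff₀ (floorMoebius_denom_pos hK s) (floorMoebius_denom_pos hK t)]
    nlinarith [mul_pos hK (sub_pos.2 hf)]

theorem floorMoebius_floorMoebius_inv (hK : 0 < K) (t : ℝ) :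
    floorMoebius K (floorMoebius K⁻¹ t) = t := by
  have hK' := inv_pos.2 hK
  have hd := floorMoebius_denom_pos hK' t
  rw [floorMoebius, floor_floorMoebius hK', fract_floorMoebius hK']
  set s := Int.fract t with hs
  have h : s / (s + K⁻¹ * (1 - s)) + K * (1 - s / (s + K⁻¹ * (1 - s))) =
      1 / (s + K⁻¹ * (1 - s)) := by
    rw [← mul_left_inj' hd.ne', add_mul, mul_assoc K, sub_mul, div_mul_cancel₀ _ hd.ne',
      div_mul_cancel₀ _ hd.ne']
    field_simp
    ring
  rw [h, div_div_div_cancel_right₀ hd.ne', div_one, hs, Int.floor_add_fract]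

theorem floorMoebius_add_one (t : ℝ) : floorMoebius K (t + 1) = floorMoebius K t + 1 := by
  simp only [floorMoebius, Int.floor_add_one, Int.fract_add_one]
  push_cast
  ring

/-- `floorMoebius K` as an order automorphism of the line. -/
noncomputable def floorMoebiusIso (hK : 0 < K) : ℝ ≃o ℝ :=
  (floorMoebius_strictMono hK).orderIsoOfRightInverse _ (floorMoebius K⁻¹)
    (floorMoebius_floorMoebius_inv hK)

theorem addRight_pow_apply (c : ℝ) (k : ℕ) (t : ℝ) :
    ((OrderIso.addRight c : ℝ ≃o ℝ) ^ k) t = t + k * c := by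
  induction k generalizing t with
  | zero => simp
  | succ k ih =>
    rw [pow_succ, RelIso.mul_apply, ih]
    simp only [OrderIso.addRight_apply]
    push_cast
    ring

theorem addRight_inv_pow {k : ℕ} (hk : 0 < k) :
    (OrderIso.addRight (1 / (k : ℝ)) : ℝ ≃o ℝ) ^ k = OrderIso.addRight 1 := by
  ext t
  rw [addRight_pow_apply]
  have : (k : ℝ) ≠ 0 := by positivity
  simp [this]

/-- `X` is translation by `1 / m`, and `Y` is translation by `1 / n` conjugated by a map `Θ` that
commutes with integer translations; both powers are then translation by `1`. -/
theorem exists_action {m n : ℕ} (hm : 2 ≤ m) (hn : 2 ≤ n) :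
    ∃ X Y : ℝ ≃o ℝ, X ^ m = Y ^ n ∧ X ^ m = OrderIso.addRight 1 ∧ X 0 = 1 / m ∧ X 1 = 1 + 1 / m ∧
      Y (1 / m) = 1 := by
  have hm' : (2 : ℝ) ≤ m := by exact_mod_cast hm
  have hn' : (2 : ℝ) ≤ n := by exact_mod_cast hn
  -- This value of `K` is chosen so that `Θ` sends `1 - 1 / n` to `1 / m`; as `Θ` fixes `1`, this
  -- gives `Y (1 / m) = 1`.
  have hK : 0 < ((m : ℝ) - 1) * (n - 1) := mul_pos (by linarith) (by linarith)
  set Θ := floorMoebiusIso hK with hΘdef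
  have hΘ : ∀ t, Θ t = floorMoebius (((m : ℝ) - 1) * (n - 1)) t := fun t => rfl
  have hcomm : Θ * OrderIso.addRight 1 * Θ⁻¹ = (OrderIso.addRight 1 : ℝ ≃o ℝ) := by
    rw [mul_inv_eq_iff_eq_mul]
    ext t
    simp only [RelIso.mul_apply, OrderIso.addRight_apply, hΘ, floorMoebius_add_one]
  refine ⟨OrderIso.addRight (1 / (m : ℝ)), Θ * OrderIso.addRight (1 / (n : ℝ)) * Θ⁻¹, ?_,
    addRight_inv_pow (by omega), by simp, by simp, ?_⟩
  · rw [conj_pow, addRight_inv_pow (by omega), addRight_inv_pow (by omega), hcomm]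
  · have hfr : Int.fract (1 - 1 / (n : ℝ)) = 1 - 1 / (n : ℝ) := by
      rw [Int.fract_eq_self]
      have h1 : 0 < 1 / (n : ℝ) := by positivity
      have h2 : 1 / (n : ℝ) ≤ 1 := by
        rw [div_le_one (by linarith)]
        linarith
      constructor <;> linarith
    have hfl : ⌊1 - 1 / (n : ℝ)⌋ = 0 := by
      have := Int.floor_add_fract (1 - 1 / (n : ℝ))
      rw [hfr] at this
      exact_mod_cast add_eq_right.1 this
    have h1 : Θ (1 - 1 / n) = 1 / m := by
      rw [hΘ, floorMoebius, hfr, hfl]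
      have : (n : ℝ) - 1 ≠ 0 := by linarith
      have : (n : ℝ) ≠ 0 := by linarith
      have : (m : ℝ) ≠ 0 := by linarith
      have h3 : 1 - 1 / (n : ℝ) + (m - 1) * (n - 1) * (1 - (1 - 1 / (n : ℝ))) =
          m * ((n - 1) / n) := by
        field_simp
        ring
      have h4 : 1 - 1 / (n : ℝ) = (n - 1) / n := by field_simp
      rw [h3, h4]
      field_simp
      simp
    have h2 : Θ⁻¹ (1 / m) = 1 - 1 / n := Θ.symm_apply_eq.2 h1.symm
    rw [RelIso.mul_apply, RelIso.mul_apply, h2]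
    simp [hΘ, floorMoebius]

end Action

/-! ### Positive words and conjugates of the orderings -/

section Words

variable {G : Type*} [Group G] {a b : G}

theorem wordValue_append {k : ℕ} (s : Fin k → G) (v w : List (Fin k × Bool)) :
    wordValue s (v ++ w) = wordValue s v * wordValue s w := by
  simp [wordValue]

theorem wordValue_cons {k : ℕ} (s : Fin k → G) (p : Fin k × Bool) (w : List (Fin k × Bool)) :
    wordValue s (p :: w) = (if p.2 then s p.1 else (s p.1)⁻¹) * wordValue s w := by
  simp [wordValue]

theorem wordValue_mem_halfMonoid {w : List (Fin 2 × Bool)} (hw : (0, false) ∉ w) :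
    wordValue ![a * b, b⁻¹] w ∈ halfMonoid a b := by
  have hb : ∀ k : ℤ, b ^ k ∈ halfMonoid a b := zpow_mem_halfMonoid
  induction w with
  | nil => simp [wordValue]
  | cons p w ih =>
    rw [wordValue_cons]
    refine mul_mem ?_ (ih fun h => hw (List.mem_cons_of_mem _ h))
    obtain ⟨i, e⟩ := p
    fin_cases i <;> cases e
    · simp at hw
    · simpa using mul_mem left_mem_halfMonoid (by simpa using hb 1)
    · simpa using hb 1
    · simpa using hb (-1)

theorem exists_word_of_mem_halfMonoid {g : G} (hg : g ∈ halfMonoid a b) :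
    ∃ w : List (Fin 2 × Bool), (0, false) ∉ w ∧ wordValue ![a * b, b⁻¹] w = g := by
  induction hg using Submonoid.closure_induction_left with
  | one => exact ⟨[], by simp, by simp [wordValue]⟩
  | mul_left x hx y hy ih =>
    obtain ⟨w, hw, rfl⟩ := ih
    rcases hx with rfl | rfl | rfl
    · exact ⟨(0, true) :: (1, true) :: w, by simpa using hw, by simp [wordValue_cons]⟩
    · exact ⟨(1, false) :: w, by simpa using hw, by simp [wordValue_cons]⟩
    · exact ⟨(1, true) :: w, by simpa using hw, by simp [wordValue_cons]⟩

theorem wordValue_eq_pow {w : List (Fin 2 × Bool)} (hw : ∀ p ∈ w, p = (1, true)) :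
    wordValue ![a * b, b⁻¹] w = b⁻¹ ^ w.length := by
  rw [List.eq_replicate_of_mem hw]
  simp [wordValue]

theorem sigmaPositive_eq_relCone :
    sigmaPositive ![a * b, b⁻¹] = relCone (halfCone a b) b⁻¹ := by
  ext g
  constructor
  · rintro ⟨i, w, ⟨h1, h2, h3⟩, rfl⟩
    fin_cases i
    · left
      obtain ⟨u, v, rfl⟩ := List.append_of_mem h1
      rw [wordValue_append, wordValue_cons]
      have hu := wordValue_mem_halfMonoid (a := a) (b := b) (w := u) fun h => h2 (by simp [h])
      have hv := wordValue_mem_halfMonoid (a := a) (b := b) (w := v) fun h => h2 (by simp [h])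
      have hb : b ∈ halfMonoid a b := by simpa using zpow_mem_halfMonoid (a := a) (b := b) 1
      refine mul_halfCone_mem hu (halfCone_mul_mem ?_ hv)
      simpa using halfCone_mul_mem left_mem_halfCone hb
    · right
      refine ⟨w.length, List.length_pos_of_mem h1, wordValue_eq_pow ?_⟩
      rintro ⟨j, e⟩ hp
      fin_cases j
      · exact absurd hp (h3 0 (by decide) e)
      · cases e
        · exact absurd hp h2
        · rfl
  · rintro (⟨k, p, hp, rfl⟩ | ⟨k, hk, rfl⟩)
    · obtain ⟨u, hu, hu'⟩ := exists_word_of_mem_halfMonoid (zpow_mem_halfMonoid (a := a) (b := b) k)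
      obtain ⟨v, hv, hv'⟩ := exists_word_of_mem_halfMonoid hp
      -- The letter `a` is spelled `(a b) b⁻¹`.
      refine ⟨0, u ++ (0, true) :: (1, true) :: v, ⟨by simp, by simpa using ⟨hu, hv⟩, by simp⟩, ?_⟩
      simp [wordValue_append, wordValue_cons, hu', hv']
    · refine ⟨1, List.replicate k (1, true), ⟨by simp; omega, by simp, by simp⟩, ?_⟩
      simp [wordValue]

end Words

/-! ### Consequences of the relation between `a` and `b`. -/

section Conjugation

variable {G : Type*} [Group G] {a b : G} {M N : ℕ}

theorem conj_inv_left_eq (hrel : a = b * (a ^ (M + 2) * b) ^ (N + 1)) :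
    a⁻¹ * b⁻¹ * a = a ^ (M + 1) * b * (a ^ (M + 2) * b) ^ N := by
  have h : b⁻¹ * a = (a ^ (M + 2) * b) ^ (N + 1) := inv_mul_eq_iff_eq_mul.2 hrel
  rw [mul_assoc, h, inv_mul_eq_iff_eq_mul]
  simp only [pow_succ' _ (M + 1), pow_succ' _ N, mul_assoc]

theorem conj_inv_right_eq (hrel : a = b * (a ^ (M + 2) * b) ^ (N + 1)) :
    a * b⁻¹ * a⁻¹ = b * (a ^ (M + 2) * b) ^ N * a ^ (M + 1) := by
  rw [mul_inv_eq_iff_eq_mul, mul_inv_eq_iff_eq_mul]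
  refine hrel.trans ?_
  simp only [pow_succ _ (M + 1), pow_succ _ N, mul_assoc]

theorem right_mem_halfMonoid : b ∈ halfMonoid a b := by
  simpa using zpow_mem_halfMonoid (a := a) (b := b) 1

theorem pow_mul_mem_halfMonoid (i : ℕ) : a ^ i * b ∈ halfMonoid a b :=
  mul_mem (pow_mem left_mem_halfMonoid _) right_mem_halfMonoid

theorem conj_inv_left_mem_halfCone (hrel : a = b * (a ^ (M + 2) * b) ^ (N + 1)) :
    a⁻¹ * b⁻¹ * a ∈ halfCone a b := by
  rw [conj_inv_left_eq hrel, pow_succ', mul_assoc, mul_assoc]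
  exact halfCone_mul_mem left_mem_halfCone (mul_mem (pow_mem left_mem_halfMonoid _)
    (mul_mem right_mem_halfMonoid (pow_mem (pow_mul_mem_halfMonoid _) _)))

theorem conj_inv_right_mem_halfCone (hrel : a = b * (a ^ (M + 2) * b) ^ (N + 1)) :
    a * b⁻¹ * a⁻¹ ∈ halfCone a b := by
  rw [conj_inv_right_eq hrel, pow_succ _ M]
  exact mul_halfCone_mem (mul_mem right_mem_halfMonoid (pow_mem (pow_mul_mem_halfMonoid _) _))
    (mul_halfCone_mem (pow_mem left_mem_halfMonoid _) left_mem_halfCone)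

/-- The Conradian condition fails at `g = a b⁻¹ a⁻¹`, `f = b g`, `k = 2`. The inverse of `g⁻¹ f g ^
2` is `a b ^ 3 (a⁻¹ b⁻¹ a) b⁻¹ a⁻¹`; expanding the bracket by the relation cancels the trailing `b⁻¹
a⁻¹`. -/
theorem inv_mul_mul_sq_mem_halfCone (hrel : a = b * (a ^ (M + 2) * b) ^ (N + 1)) :
    ((a * b⁻¹ * a⁻¹)⁻¹ * (b * (a * b⁻¹ * a⁻¹) * (a * b⁻¹ * a⁻¹) ^ 2))⁻¹ ∈ halfCone a b := by
  have h : ((a * b⁻¹ * a⁻¹)⁻¹ * (b * (a * b⁻¹ * a⁻¹) * (a * b⁻¹ * a⁻¹) ^ 2))⁻¹ =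
      a * b ^ 3 * (a⁻¹ * b⁻¹ * a) * b⁻¹ * a⁻¹ := by
    rw [pow_two]
    group
  have ha : a ∈ halfMonoid a b := left_mem_halfMonoid
  rw [h, conj_inv_left_eq hrel]
  have hmem : ∀ p ∈ halfMonoid a b, a * (b ^ 3 * p) ∈ halfCone a b := fun p hp =>
    halfCone_mul_mem left_mem_halfCone (mul_mem (pow_mem right_mem_halfMonoid _) hp)
  cases N with
  | zero =>
    convert hmem (a ^ M) (pow_mem ha _) using 1
    simp only [pow_succ _ M]
    group
  | succ N =>
    convert hmem (a ^ (M + 1) * b * (a ^ (M + 2) * b) ^ N * a ^ (M + 1))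
      (mul_mem (mul_mem (pow_mul_mem_halfMonoid _) (pow_mem (pow_mul_mem_halfMonoid _) _))
        (pow_mem ha _)) using 1
    rw [pow_succ _ N, mul_inv_eq_iff_eq_mul, mul_inv_eq_iff_eq_mul]
    simp only [pow_succ _ (M + 1), mul_assoc]

open LeftOrdering

theorem eventually_mem_pos_conj (hQ : IsRelCone (halfCone a b) b)
    (hrel : a = b * (a ^ (M + 2) * b) ^ (N + 1)) {u : G} (hu : u ∈ hQ.inv.ordering.pos) :
    ∀ᶠ i : ℕ in atTop, u ∈ (hQ.inv.ordering.conj (b ^ i * a)).pos := by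
  have hc := conj_inv_left_mem_halfCone hrel
  have hconj : ∀ j : ℕ, a⁻¹ * b⁻¹ ^ j * a = (a⁻¹ * b⁻¹ * a) ^ j := fun j => by
    simpa using (conj_pow (i := j) (a := a⁻¹) (b := b⁻¹)).symm
  rw [hQ.inv.pos_ordering] at hu
  rcases hu with ⟨k, p, hp, rfl⟩ | ⟨k, hk, rfl⟩
  · filter_upwards [eventually_ge_atTop k.toNat] with i hi
    rw [mem_pos_conj, hQ.inv.pos_ordering]
    left
    obtain ⟨j, hj⟩ : ∃ j : ℕ, k - i = -j := ⟨(i - k).toNat, by omega⟩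
    have h : (b ^ i * a)⁻¹ * (b ^ k * (a * p)) * (b ^ i * a) =
        (a⁻¹ * b ^ (k - i) * a) * (p * b ^ (i : ℤ) * a) := by
      rw [zpow_sub, zpow_natCast, ((Commute.refl b).zpow_left k).pow_right i |>.inv_right.eq]
      group
    rw [h, hj, zpow_neg, zpow_natCast, ← inv_pow, hconj]
    exact mul_halfCone_mem (pow_mem (halfCone_subset_halfMonoid hc) _)
      (mul_halfCone_mem (mul_mem hp (zpow_mem_halfMonoid _)) left_mem_halfCone)
  · refine Eventually.of_forall fun i => ?_
    rw [mem_pos_conj, hQ.inv.pos_ordering]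
    left
    have h : (b ^ i * a)⁻¹ * b⁻¹ ^ k * (b ^ i * a) = a⁻¹ * b⁻¹ ^ k * a := by
      have := (((Commute.refl b).inv_left).pow_left k).pow_right i
      rw [mul_assoc, ← mul_assoc (b⁻¹ ^ k), this.eq]
      group
    obtain ⟨j, rfl⟩ : ∃ j, k = j + 1 := ⟨k - 1, by omega⟩
    rw [h, hconj, pow_succ']
    exact halfCone_mul_mem hc (pow_mem (halfCone_subset_halfMonoid hc) _)

theorem conj_ne (hQ : IsRelCone (halfCone a b) b)
    (hrel : a = b * (a ^ (M + 2) * b) ^ (N + 1)) (i : ℕ) :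
    hQ.inv.ordering.conj (b ^ i * a) ≠ hQ.inv.ordering := by
  intro heq
  have hpos : ∀ q ∈ halfCone a b, q ∈ hQ.inv.ordering.pos := fun q hq =>
    hQ.inv.pos_ordering ▸ Or.inl hq
  -- A positive element whose conjugate by `b ^ i a` is `a⁻¹ b a b⁻¹`, the inverse of `b (a⁻¹ b⁻¹ a)
  -- ∈ Q`.
  have hu : b ^ ((i : ℤ) + 1) * (a * b⁻¹ * a⁻¹) * b ^ (-(i : ℤ)) ∈ hQ.inv.ordering.pos :=
    hpos _ (hQ.mul_zpow _ _ (hQ.zpow_mul _ _ (conj_inv_right_mem_halfCone hrel)))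
  rw [← heq, mem_pos_conj] at hu
  refine hQ.inv.ordering.inv_notMem_pos hu ?_
  convert hpos _ (hQ.zpow_mul 1 _ (conj_inv_left_mem_halfCone hrel)) using 1
  group

theorem accPt_conj (hQ : IsRelCone (halfCone a b) b)
    (hrel : a = b * (a ^ (M + 2) * b) ^ (N + 1)) :
    AccPt hQ.inv.ordering (𝓟 (Set.range fun g : G => hQ.inv.ordering.conj g)) := by
  rw [accPt_iff_frequently]
  have ht : Tendsto (fun i : ℕ => hQ.inv.ordering.conj (b ^ i * a)) atTop
      (𝓝 hQ.inv.ordering) :=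
    tendsto_of_eventually _ _ fun u hu => eventually_mem_pos_conj hQ hrel hu
  exact ht.frequently (Eventually.of_forall fun i => ⟨conj_ne hQ hrel i, _, rfl⟩).frequently

end Conjugation

/-! ### The groups `⟨x, y | x ^ m = y ^ n⟩` -/

theorem eq_mul_pow_of_pow_eq {G : Type*} [Group G] {a b : G} {M N : ℕ}
    (h : a ^ (M + 3) = (b * a ^ (M + 2)) ^ (N + 2)) : a = b * (a ^ (M + 2) * b) ^ (N + 1) := by
  rw [pow_succ _ (N + 1), ← mul_assoc, mul_pow_mul, pow_succ' _ (M + 2)] at h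
  exact mul_right_cancel h

namespace TorusGroup

variable {m n : ℕ}

theorem x_pow_eq_y_pow : x m n ^ m = y m n ^ n := by
  have h : (PresentedGroup.mk
      ({FreeGroup.of 0 ^ m * (FreeGroup.of 1 ^ n)⁻¹} : Set (FreeGroup (Fin 2))))
      (FreeGroup.of 0 ^ m * (FreeGroup.of 1 ^ n)⁻¹) = 1 :=
    PresentedGroup.one_of_mem rfl
  rw [map_mul, map_inv, map_pow, map_pow, mul_inv_eq_one] at h
  exact h

theorem closure_x_y : Subgroup.closure {x m n, y m n} = ⊤ := by
  rw [← PresentedGroup.closure_range_of]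
  congr 1
  ext g
  simp [Set.mem_range, Fin.exists_fin_two, x, y, eq_comm]

/-- The homomorphism determined by a solution of `X ^ m = Y ^ n`. -/
def lift {H : Type*} [Group H] (X Y : H) (h : X ^ m = Y ^ n) : TorusGroup m n →* H :=
  PresentedGroup.toGroup (f := ![X, Y]) (by
    rintro _ rfl
    simp [h])

theorem lift_x {H : Type*} [Group H] (X Y : H) (h : X ^ m = Y ^ n) : lift X Y h (x m n) = X :=
  PresentedGroup.toGroup.of _

theorem lift_y {H : Type*} [Group H] (X Y : H) (h : X ^ m = Y ^ n) : lift X Y h (y m n) = Y :=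
  PresentedGroup.toGroup.of _

theorem s₁_eq : s₁ m n = a m n * b m n := by
  simp [s₁, a, b, mul_assoc]

theorem s₂_eq : s₂ m n = (b m n)⁻¹ := by
  rw [s₂, b, mul_inv_rev, ← zpow_neg]
  congr 2
  ring

theorem S_eq : S m n = ![a m n * b m n, (b m n)⁻¹] := by
  rw [S, s₁_eq, s₂_eq]

theorem b_mul_pow (hm : 1 ≤ m) : b m n * x m n ^ (m - 1) = y m n := by
  rw [b, mul_assoc, ← zpow_natCast (x m n), ← zpow_add]
  simp [Nat.cast_sub hm]

theorem b_mul_x_pow (hm : 1 ≤ m) : b m n * x m n ^ m = y m n * x m n := by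
  rw [← b_mul_pow hm, mul_assoc, ← pow_succ, Nat.sub_add_cancel hm]

theorem closure_a_b (hm : 1 ≤ m) : Subgroup.closure {a m n, b m n} = ⊤ := by
  have ha : a m n ∈ Subgroup.closure {a m n, b m n} := Subgroup.subset_closure (by simp)
  have hb : b m n ∈ Subgroup.closure {a m n, b m n} := Subgroup.subset_closure (by simp)
  rw [eq_top_iff, ← closure_x_y, Subgroup.closure_le]
  rintro _ (rfl | rfl)
  · exact ha
  · rw [← b_mul_pow hm]
    exact mul_mem hb (pow_mem ha _)

theorem closure_range_S (hm : 1 ≤ m) : Subgroup.closure (Set.range (S m n)) = ⊤ := by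
  have h1 : a m n * b m n ∈ Subgroup.closure (Set.range (S m n)) :=
    Subgroup.subset_closure ⟨0, by simp [S_eq]⟩
  have h2 : (b m n)⁻¹ ∈ Subgroup.closure (Set.range (S m n)) :=
    Subgroup.subset_closure ⟨1, by simp [S_eq]⟩
  rw [eq_top_iff, ← closure_a_b hm, Subgroup.closure_le]
  rintro _ (rfl | rfl)
  · simpa using mul_mem h1 h2
  · simpa using inv_mem h2

theorem range_A : Set.range (A m n) = {a m n, b m n} := by
  ext g
  simp [A, or_comm]

theorem a_eq {M N : ℕ} :
    a (M + 3) (N + 2) =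
      b (M + 3) (N + 2) *
        (a (M + 3) (N + 2) ^ (M + 2) * b (M + 3) (N + 2)) ^ (N + 1) := by
  have h := x_pow_eq_y_pow (m := M + 3) (n := N + 2)
  rw [← b_mul_pow (by omega), show M + 3 - 1 = M + 2 by omega] at h
  exact eq_mul_pow_of_pow_eq h

/-- The map to `ℤ` with `x ↦ n`, `y ↦ m` sends `b` to `m + n - m n`, which vanishes for `m = n = 2`
but is negative here. -/
theorem b_pow_ne_one (hn : 2 ≤ n) (hm : 3 ≤ m) (k : ℕ) (hk : 0 < k) :
    b m n ^ k ≠ 1 := by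
  intro h
  have hX : Multiplicative.ofAdd (n : ℤ) ^ m = Multiplicative.ofAdd (m : ℤ) ^ n := by
    rw [← ofAdd_nsmul, ← ofAdd_nsmul]
    simp [mul_comm]
  have h2 := congrArg (lift (m := m) (n := n) _ _ hX) h
  rw [map_pow, b, map_mul, map_zpow, lift_x, lift_y, map_one, ← ofAdd_zsmul, ← ofAdd_add,
    ← ofAdd_nsmul, ofAdd_eq_one, smul_eq_zero] at h2
  rcases h2 with h2 | h2
  · omega
  · have hm' : (3 : ℤ) ≤ m := by exact_mod_cast hm
    have hn' : (2 : ℤ) ≤ n := by exact_mod_cast hn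
    rw [smul_eq_mul] at h2
    nlinarith

theorem one_notMem_halfCone (hm : 2 ≤ m) (hn : 2 ≤ n) : (1 : TorusGroup m n) ∉
    halfCone (a m n) (b m n) := by
  obtain ⟨X, Y, hXY, hX, hX0, hX1, hY⟩ := exists_action hm hn
  have hm0 : 0 < 1 / (m : ℝ) := by positivity
  refine _root_.one_notMem_halfCone (lift X Y hXY) 1 ?_ ?_
  · have h := congrArg (fun g => lift X Y hXY g 0) (b_mul_x_pow (n := n) (show 1 ≤ m by omega))
    simpa [lift_x, lift_y, hX, hX0, ← one_div, hY] using h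
  · rw [a, lift_x, hX1]
    linarith

theorem mem_closure_a_b_or (hm : 2 ≤ m) (hn : 2 ≤ n) (g : TorusGroup m n) :
    g ∈ Submonoid.closure {a m n, b m n} ∨ g⁻¹ ∈ Submonoid.closure {a m n, b m n} :=
  mem_closure_or_inv_mem_closure hm hn x_pow_eq_y_pow closure_x_y (b_mul_pow (by omega)) g

theorem isRelCone (hn : 2 ≤ n) (hm : 3 ≤ m) :
    IsRelCone (halfCone (a m n) (b m n)) (b m n) :=
  isRelCone_halfCone (one_notMem_halfCone (by omega) hn) (b_pow_ne_one hn hm)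
    (mem_closure_a_b_or (by omega) hn)

end TorusGroup

open TorusGroup in
theorem corollary3p1 (m n : ℕ) (hn : 2 ≤ n) (hnm : n ≤ m) (hmn : (m, n) ≠ (2, 2)) :
    ∃ D A : LeftOrdering (TorusGroup m n),
      IsDehornoyLike (TorusGroup.S m n) D ∧
      DefinesIsolated (TorusGroup.A m n) A ∧
      (∀ H : Subgroup (TorusGroup m n), D.IsConvex H ↔
        H = ⊥ ∨ H = Subgroup.zpowers (TorusGroup.s₂ m n) ∨ H = ⊤) ∧
      (∀ H : Subgroup (TorusGroup m n), A.IsConvex H ↔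
        H = ⊥ ∨ H = Subgroup.zpowers (TorusGroup.b m n) ∨ H = ⊤) ∧
      D.IsConradianSoul (Subgroup.zpowers (TorusGroup.s₂ m n)) ∧
      A.IsConradianSoul (Subgroup.zpowers (TorusGroup.b m n)) ∧
      AccPt D (𝓟 (Set.range fun g : TorusGroup m n => D.conj g)) ∧
      ¬ D.IsIsolated ∧
      ¬ (Submonoid.closure (sigmaPositive (TorusGroup.S m n))).FG := by
  have hm : 3 ≤ m := by
    rcases Nat.lt_or_ge m 3 with h | h
    · exact absurd (Prod.ext (by simp; omega) (by simp; omega)) hmn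
    · exact h
  -- The shift by `3` makes `m - 2 = M + 1` positive, so that `a` really occurs in the words for the
  -- conjugates of `b⁻¹`.
  obtain ⟨M, rfl⟩ : ∃ M, m = M + 3 := ⟨m - 3, by omega⟩
  obtain ⟨N, rfl⟩ : ∃ N, n = N + 2 := ⟨n - 2, by omega⟩
  have hQ := isRelCone hn hm
  have hrel := a_eq (M := M) (N := N)
  have htop := closure_a_b (m := M + 3) (n := N + 2) (by omega)
  have hfact : ∀ q ∈ halfCone (a (M + 3) (N + 2)) (b (M + 3) (N + 2)), ∃ k : ℤ, ∃ p,
      (p ∈ halfCone (a (M + 3) (N + 2)) (b (M + 3) (N + 2)) ∨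
        p ∈ Subgroup.zpowers (b (M + 3) (N + 2))) ∧
      q = b (M + 3) (N + 2) ^ k * (a (M + 3) (N + 2) * p) := by
    rintro q ⟨k, p, hp, rfl⟩
    exact ⟨k, p, mem_halfMonoid_iff.1 hp, rfl⟩
  have hconvA := hQ.isConvex_iff htop left_mem_halfCone hfact
  have hconvD := hQ.inv.isConvex_iff (a := a (M + 3) (N + 2))
    (by
      rw [eq_top_iff, ← htop, Subgroup.closure_le]
      rintro _ (rfl | rfl)
      · exact Subgroup.subset_closure (by simp)
      · exact inv_mem_iff.1 (Subgroup.subset_closure (by simp)))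
    left_mem_halfCone
    (by
      intro q hq
      obtain ⟨k, p, hp, h⟩ := hfact q hq
      exact ⟨-k, p, by simpa using hp, by simpa using h⟩)
  have hg := conj_inv_right_mem_halfCone hrel
  have hf := mul_halfCone_mem right_mem_halfMonoid hg
  have hfg := inv_mul_mul_sq_mem_halfCone hrel
  have hacc := accPt_conj hQ hrel
  have hiso := hQ.inv.ordering.not_isIsolated_of_accPt hacc
  have hposD : hQ.inv.ordering.pos = sigmaPositive (S (M + 3) (N + 2)) := by
    rw [hQ.inv.pos_ordering, S_eq, sigmaPositive_eq_relCone]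
  have hposA : hQ.ordering.pos = Subsemigroup.closure {a (M + 3) (N + 2), b (M + 3) (N + 2)} := by
    rw [hQ.pos_ordering, subsemigroup_closure_eq_relCone hQ.one_notMem
      (mem_closure_a_b_or (by omega) hn)]
  rw [s₂_eq]
  refine ⟨hQ.inv.ordering, hQ.ordering, ⟨closure_range_S (by omega), hposD⟩,
    ⟨by rw [range_A, htop], by rw [wordPositive, range_A, hposA], ?_⟩, hconvD, hconvA,
    hQ.inv.isConradianSoul_zpowers (fun H => (hconvD H).1) hf hg hfg,
    hQ.isConradianSoul_zpowers (fun H => (hconvA H).1) hf hg hfg, hacc, hiso, ?_⟩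
  · refine hQ.ordering.isIsolated_of_finite
      (F := {a (M + 3) (N + 2), b (M + 3) (N + 2)}) (Set.toFinite _) ?_ ?_
    · rw [hposA]
      exact Subsemigroup.subset_closure
    · rw [hposA]
      intro g hg
      induction hg using Subsemigroup.closure_induction with
      | mem x hx => exact Submonoid.subset_closure hx
      | mul x y _ _ hx hy => exact mul_mem hx hy
  · rw [← hposD]
    exact hQ.inv.ordering.not_fg_of_not_isIsolated hiso
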